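/- Let $k, L \ge 1$ be integers and let $a = (a_1,\dots,a_k) \in \mathbb{C}^k$ with $a \neq 0$. Write $\|\cdot\|_2$ for the Euclidean ($\ell_2$) norm on $\mathbb{C}^k$ and on $\mathbb{C}^L$. (i) Let $Z_1,\dots,Z_k$ be independent random vectors, each uniformly distributed on the real unit sphere $S^{L-1} = \{x \in \mathbb{R}^L : \|x\|_2 = 1\}$. Then for every real $u > 1$ $$\mathbb{P}\Big(\Big\|\sum_{j=1}^k a_j Z_j\Big\|_2 \ge u\|a\|_2\Big) \le \exp\Big(-\frac{L}{2}\big(u^2 - \log(u^2) - 1\big)\Big).$$ (ii) Let $Z_1,\dots,Z_k$ be independent random vectors, each uniformly distributed on the complex unit sphere $S^{L-1}_{\mathbb{C}} = \{x \in \mathbb{C}^L : \|x\|_2 = 1\}$. Then for every real $u > 1$ $$\mathbb{P}\Big(\Big\|\sum_{j=1}^k a_j Z_j\Big\|_2 \ge u\|a\|_2\Big) \le \exp\Big(-L\big(u^2 - \log(u^2) - 1\big)\Big).$$ -/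

import Mathlib

open MeasureTheory ProbabilityTheory

/-- The uniform probability distribution on the unit sphere `{x : ‖x‖ = 1}` of a finite-dimensional
real Euclidean space, as a measure on the ambient space: the surface measure that
Lebesgue measure induces on the sphere, normalised to have total mass `1`.
It is used for `ℝ^L` and for `ℂ^L` (regarded as a real Euclidean space of dimension `2 L`). -/
noncomputable def uniformOnSphere (E : Type*) [NormedAddCommGroup E] [InnerProductSpace ℝ E]
    [FiniteDimensional ℝ E] [MeasurableSpace E] [BorelSpace E] : Measure E :=
  (((volume : Measure E).toSphere Set.univ)⁻¹ • (volume : Measure E).toSphere).map Subtype.val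

/-- The inclusion `ℝ^L ⊆ ℂ^L`. -/
noncomputable def realToComplex {L : ℕ} (x : EuclideanSpace ℝ (Fin L)) :
    EuclideanSpace ℂ (Fin L) :=
  WithLp.toLp 2 fun i => (x i : ℂ)

open MeasureTheory ProbabilityTheory

open scoped InnerProductSpace

/-! The sum is compared with a Gaussian vector. If `x` is standard Gaussian in real dimension `n`,
its direction is independent of its norm and `‖x‖ ^ 2` has mean `n`. Since `s ↦ cosh (√s * y)` is
convex, Jensen's inequality over the norm bounds the Laplace transform of a uniform unit vector by
that of `x / √n` (`integral_rexp_inner_uniformOnSphere_le`).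

Such bounds multiply over independent summands. Averaging over a Gaussian argument `v` turns them
into a chi-squared bound on `exp (s * ‖S‖ ^ 2)` (`lintegral_rexp_mul_sq_norm_le`), and Chernoff's
bound with the optimal `s` gives the rate.

For complex spheres `n = 2 * L`, and multiplication by `a j` is a real-linear map of norm `‖a j‖`.
For real spheres `n = L`; the real and imaginary parts of the sum are dependent, and convexity of
`exp` recombines their separate bounds without loss. -/

/-- Convexity of `s ↦ cosh (√s * y)`, as a tangent line inequality at `s = 1`. -/
lemma cosh_add_mul_sinh_le_cosh_mul (y t : ℝ) :
    Real.cosh y + y * Real.sinh y / 2 * (t ^ 2 - 1) ≤ Real.cosh (t * y) := by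
  have h1 := Real.hasSum_cosh y
  have h2 := Real.hasSum_cosh (t * y)
  -- The derivative in `s` at `1` of the series of `cosh (√s * y)`, term by term.
  have h3 : HasSum (fun m : ℕ => (m : ℝ) * (y ^ (2 * m) / (2 * m).factorial))
      (y * Real.sinh y / 2) := by
    rw [← hasSum_nat_add_iff' 1]
    have h := (Real.hasSum_sinh y).mul_left (y / 2)
    convert! h using 1
    · funext m
      have e : (2 * (m + 1)).factorial = (2 * m + 2) * (2 * m + 1).factorial := by
        rw [show 2 * (m + 1) = (2 * m + 1) + 1 by ring, Nat.factorial_succ]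
      rw [e]
      have : ((2 * m + 1).factorial : ℝ) ≠ 0 := by positivity
      push_cast
      field_simp
      ring
    · simp
      ring
  refine hasSum_le (fun m => ?_) (h1.add (h3.mul_right (t ^ 2 - 1))) h2
  -- Bernoulli's inequality bounds each power of `t ^ 2` below by its tangent line at `1`.
  have hB := one_add_mul_le_pow (a := t ^ 2 - 1) (by nlinarith [sq_nonneg t]) m
  have hy : 0 ≤ y ^ (2 * m) / ((2 * m).factorial : ℝ) := by
    rw [pow_mul]; positivity
  calc _ = (1 + m * (t ^ 2 - 1)) * (y ^ (2 * m) / ((2 * m).factorial : ℝ)) := by ring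
    _ ≤ (1 + (t ^ 2 - 1)) ^ m * (y ^ (2 * m) / ((2 * m).factorial : ℝ)) := by gcongr
    _ = _ := by rw [mul_pow, add_sub_cancel, ← pow_mul]; ring

lemma ofReal_rexp_neg_mul_sq_norm_add_inner {E : Type*} [NormedAddCommGroup E]
    [InnerProductSpace ℝ E] (b : ℝ) (w v : E) :
    ((Real.exp (-b * ‖v‖ ^ 2 + ⟪w, v⟫_ℝ) : ℝ) : ℂ) =
      Complex.exp (-(b : ℂ) * (‖v‖ : ℂ) ^ 2 + 1 * (⟪w, v⟫_ℝ : ℂ)) := by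
  push_cast
  rw [one_mul]

/-! ### Gaussian integrals and linearisation of the squared norm -/

section Gaussian

variable {E : Type*} [NormedAddCommGroup E] [InnerProductSpace ℝ E] [FiniteDimensional ℝ E]
  [MeasurableSpace E] [BorelSpace E]

lemma integrable_rexp_neg_mul_sq_norm_add_inner {b : ℝ} (hb : 0 < b) (w : E) :
    Integrable (fun v : E => Real.exp (-b * ‖v‖ ^ 2 + ⟪w, v⟫_ℝ)) := by
  have h := GaussianFourier.integrable_cexp_neg_mul_sq_norm_add
    (show 0 < (b : ℂ).re from hb) 1 w
  simp_rw [← ofReal_rexp_neg_mul_sq_norm_add_inner] at h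
  exact h.re

lemma integral_rexp_neg_mul_sq_norm_add_inner {b : ℝ} (hb : 0 < b) (w : E) :
    ∫ v : E, Real.exp (-b * ‖v‖ ^ 2 + ⟪w, v⟫_ℝ) =
      (Real.pi / b) ^ (Module.finrank ℝ E / 2 : ℝ) * Real.exp (‖w‖ ^ 2 / (4 * b)) := by
  have h := GaussianFourier.integral_cexp_neg_mul_sq_norm_add
    (show 0 < (b : ℂ).re from hb) 1 w
  simp_rw [← ofReal_rexp_neg_mul_sq_norm_add_inner] at h
  rw [integral_complex_ofReal] at h
  apply Complex.ofReal_injective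
  rw [h]
  push_cast
  rw [Complex.ofReal_cpow (by positivity)]
  push_cast
  simp

lemma integrable_sq_norm_mul_rexp_neg_sq_norm_div_two [Nontrivial E] :
    Integrable (fun x : E => ‖x‖ ^ 2 * Real.exp (-‖x‖ ^ 2 / 2)) := by
  have h := integrable_rexp_neg_mul_sq_norm_add_inner (show (0 : ℝ) < 1 / 4 by norm_num) (0 : E)
  refine (h.const_mul 4).mono' (by fun_prop) (Filter.Eventually.of_forall fun x => ?_)
  rw [Real.norm_of_nonneg (by positivity), inner_zero_left, add_zero,
    -- Half of the Gaussian weight absorbs the factor `‖x‖ ^ 2`; the other half is integrable.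
    show -‖x‖ ^ 2 / 2 = -(1 / 4) * ‖x‖ ^ 2 + -(1 / 4) * ‖x‖ ^ 2 by ring, Real.exp_add, ← mul_assoc]
  gcongr
  have := Real.add_one_le_exp (1 / 4 * ‖x‖ ^ 2)
  rw [neg_mul, Real.exp_neg, ← div_eq_mul_inv, div_le_iff₀ (Real.exp_pos _)]
  linarith

lemma integrable_rexp_neg_sq_norm_div_two :
    Integrable (fun x : E => Real.exp (-‖x‖ ^ 2 / 2)) := by
  have h := integrable_rexp_neg_mul_sq_norm_add_inner (show (0 : ℝ) < 1 / 2 by norm_num) (0 : E)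
  refine h.congr (Filter.Eventually.of_forall fun x => ?_)
  simp only [inner_zero_left, add_zero]
  ring_nf

/-- In polar coordinates this is `Γ(n/2 + 1) = (n/2) Γ(n/2)`. It makes the first-order term vanish
in the Jensen argument. -/
lemma integral_sq_norm_sub_finrank_mul_rexp [Nontrivial E] :
    ∫ x : E, (‖x‖ ^ 2 - Module.finrank ℝ E) * Real.exp (-‖x‖ ^ 2 / 2) = 0 := by
  set n := Module.finrank ℝ E with hn
  have hn0 : 0 < n := Module.finrank_pos
  have hn0' : (0 : ℝ) < n := by exact_mod_cast hn0
  rw [integral_fun_norm_addHaar (volume : Measure E)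
    (fun r : ℝ => (r ^ 2 - n) * Real.exp (-r ^ 2 / 2))]
  have hG : ∀ q : ℝ, -1 < q → ∫ x in Set.Ioi (0 : ℝ), x ^ q * Real.exp (-(1 / 2) * x ^ (2 : ℝ)) =
      (1 / 2) ^ (-(q + 1) / 2) * (1 / 2) * Real.Gamma ((q + 1) / 2) := fun q hq =>
    integral_rpow_mul_exp_neg_mul_rpow two_pos hq (by norm_num)
  have hI : ∀ q : ℝ, -1 < q →
      IntegrableOn (fun x : ℝ => x ^ q * Real.exp (-(1 / 2) * x ^ (2 : ℝ))) (Set.Ioi 0) :=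
    fun q hq => integrableOn_rpow_mul_exp_neg_mul_rpow hq two_pos (by norm_num)
  have key : ∫ y in Set.Ioi (0 : ℝ), y ^ (n - 1) • ((y ^ 2 - n) * Real.exp (-y ^ 2 / 2)) =
      0 := by
    have e : ∀ y ∈ Set.Ioi (0 : ℝ), y ^ (n - 1) • ((y ^ 2 - n) * Real.exp (-y ^ 2 / 2)) =
        y ^ (n + 1 : ℝ) * Real.exp (-(1 / 2) * y ^ (2 : ℝ)) -
          n * (y ^ (n - 1 : ℝ) * Real.exp (-(1 / 2) * y ^ (2 : ℝ))) := by
      intro y hy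
      have e1 : y ^ (n + 1 : ℝ) = y ^ (n + 1) := by exact_mod_cast Real.rpow_natCast y (n + 1)
      have e2 : y ^ (n - 1 : ℝ) = y ^ (n - 1) := by
        rw [← Real.rpow_natCast, Nat.cast_pred hn0]
      have e3 : y ^ (2 : ℝ) = y ^ 2 := Real.rpow_two y
      rw [e1, e2, e3, show n + 1 = (n - 1) + 2 by omega, pow_add, smul_eq_mul,
        show -y ^ 2 / 2 = -(1 / 2) * y ^ 2 by ring]
      ring
    rw [setIntegral_congr_fun measurableSet_Ioi e,
      integral_sub (hI _ (by linarith)) ((hI _ (by linarith)).const_mul _),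
      integral_const_mul, hG _ (by linarith), hG _ (by linarith),
      show ((n : ℝ) + 1 + 1) / 2 = n / 2 + 1 by ring, Real.Gamma_add_one (by positivity),
      show -((n : ℝ) + 1 + 1) / 2 = -n / 2 - 1 by ring,
      Real.rpow_sub_one (by norm_num), sub_add_cancel]
    ring
  rw [key]
  simp

/-- A bound on the Laplace transform of a random vector gives a bound on the exponential moments
of its squared norm. -/
lemma lintegral_rexp_mul_sq_norm_le {Ω : Type*} [MeasurableSpace Ω] {P : Measure Ω} [SFinite P]
    {S : Ω → E} (hS : AEMeasurable S P) {τ s : ℝ} (hs : 0 < s) (hsτ : 2 * s * τ < 1)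
    (h : ∀ v : E, ∫⁻ ω, ENNReal.ofReal (Real.exp ⟪v, S ω⟫_ℝ) ∂P ≤
      ENNReal.ofReal (Real.exp (τ * ‖v‖ ^ 2 / 2))) :
    ∫⁻ ω, ENNReal.ofReal (Real.exp (s * ‖S ω‖ ^ 2)) ∂P ≤
      ENNReal.ofReal ((1 - 2 * s * τ) ^ (-(Module.finrank ℝ E : ℝ) / 2)) := by
  -- With this `b` the Gaussian integral of `exp ⟪v, w⟫` is proportional to `exp (s * ‖w‖ ^ 2)`.
  obtain ⟨b, hb⟩ : ∃ b : ℝ, b = 1 / (4 * s) := ⟨_, rfl⟩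
  have hb0 : 0 < b := by rw [hb]; positivity
  have hbs : 4 * b * s = 1 := by rw [hb]; field_simp
  -- The condition `2 * s * τ < 1` is what keeps the weight Gaussian once `h` has lowered `b` to `b
  -- - τ / 2`.
  have hbτ : 0 < b - τ / 2 := by
    have : (b - τ / 2) * (4 * s) = 1 - 2 * s * τ := by linear_combination hbs
    exact pos_of_mul_pos_left (b := 4 * s) (by rw [this]; linarith) (by positivity)
  set c : ℝ := (Real.pi / b) ^ (Module.finrank ℝ E / 2 : ℝ) with hc
  have hc0 : 0 < c := by positivity
  have hexp : ∀ w : E, ENNReal.ofReal (Real.exp (s * ‖w‖ ^ 2)) =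
      ENNReal.ofReal c⁻¹ * ∫⁻ v : E, ENNReal.ofReal (Real.exp (-b * ‖v‖ ^ 2 + ⟪v, w⟫_ℝ)) := by
    intro w
    simp_rw [real_inner_comm w]
    rw [← ofReal_integral_eq_lintegral_ofReal
        (integrable_rexp_neg_mul_sq_norm_add_inner hb0 w)
        (Filter.Eventually.of_forall fun v => (Real.exp_pos _).le),
      integral_rexp_neg_mul_sq_norm_add_inner hb0, ← hc, ← ENNReal.ofReal_mul (by positivity),
      inv_mul_cancel_left₀ hc0.ne']
    congr 2
    rw [eq_div_iff (by positivity)]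
    linear_combination ‖w‖ ^ 2 * hbs
  calc ∫⁻ ω, ENNReal.ofReal (Real.exp (s * ‖S ω‖ ^ 2)) ∂P
      = ENNReal.ofReal c⁻¹ *
        ∫⁻ ω, ∫⁻ v : E, ENNReal.ofReal (Real.exp (-b * ‖v‖ ^ 2 + ⟪v, S ω⟫_ℝ)) ∂volume ∂P := by
        simp_rw [hexp]
        rw [lintegral_const_mul' _ _ ENNReal.ofReal_ne_top]
    _ = ENNReal.ofReal c⁻¹ *
        ∫⁻ v : E, ∫⁻ ω, ENNReal.ofReal (Real.exp (-b * ‖v‖ ^ 2 + ⟪v, S ω⟫_ℝ)) ∂P := by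
        rw [lintegral_lintegral_swap]
        have h1 : AEMeasurable (fun p : Ω × E => S p.1) (P.prod volume) := hS.comp_fst
        have h2 : AEMeasurable (fun p : Ω × E => p.2) (P.prod volume) := measurable_snd.aemeasurable
        exact (((h2.norm.pow_const 2).const_mul (-b)).add (h2.inner h1)).exp.ennreal_ofReal
    _ ≤ ENNReal.ofReal c⁻¹ *
        ∫⁻ v : E, ENNReal.ofReal (Real.exp (-(b - τ / 2) * ‖v‖ ^ 2 + ⟪(0 : E), v⟫_ℝ)) := by
        gcongr with v
        simp_rw [Real.exp_add, ENNReal.ofReal_mul (Real.exp_pos _).le]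
        rw [lintegral_const_mul' _ _ ENNReal.ofReal_ne_top]
        grw [h v]
        rw [← ENNReal.ofReal_mul (Real.exp_pos _).le, ← ENNReal.ofReal_mul (Real.exp_pos _).le,
          ← Real.exp_add, ← Real.exp_add, inner_zero_left]
        apply le_of_eq
        congr 2
        ring
    _ = ENNReal.ofReal ((1 - 2 * s * τ) ^ (-(Module.finrank ℝ E : ℝ) / 2)) := by
        rw [← ofReal_integral_eq_lintegral_ofReal
            (integrable_rexp_neg_mul_sq_norm_add_inner hbτ 0)
            (Filter.Eventually.of_forall fun v => (Real.exp_pos _).le),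
          integral_rexp_neg_mul_sq_norm_add_inner hbτ, ← ENNReal.ofReal_mul (by positivity), hc,
          ← Real.inv_rpow (by positivity), norm_zero]
        have h1 : 0 < 1 - 2 * s * τ := by linarith
        rw [neg_div, Real.rpow_neg h1.le, ← Real.inv_rpow h1.le, zero_pow two_ne_zero, zero_div,
          Real.exp_zero, mul_one, ← Real.mul_rpow (by positivity) (by positivity)]
        congr 2
        rw [inv_div, div_mul_div_comm, mul_comm Real.pi, mul_div_mul_right _ _ Real.pi_ne_zero,
          eq_comm, inv_eq_one_div, div_eq_div_iff h1.ne' hbτ.ne']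
        linear_combination (τ / 2) * hbs

end Gaussian

/-! ### The uniform distribution on the sphere against a Gaussian -/

lemma norm_inv_norm_smul_le_one {E : Type*} [NormedAddCommGroup E] [NormedSpace ℝ E] (x : E) : ‖‖x‖⁻¹ • x‖ ≤ 1 := by
  rw [norm_smul, norm_inv, norm_norm]
  exact inv_mul_le_one

section Sphere

variable {E : Type*} [NormedAddCommGroup E] [InnerProductSpace ℝ E] [FiniteDimensional ℝ E]
  [MeasurableSpace E] [BorelSpace E]

/-- The origin is a null set, and off it polar coordinates turn `volume` into a product measure. -/
lemma integral_direction_mul_norm [Nontrivial E] (f : E → ℝ) (g : ℝ → ℝ) :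
    ∫ x : E, f (‖x‖⁻¹ • x) * g ‖x‖ =
      (∫ z, f z ∂(volume : Measure E).toSphere) *
        ∫ r, g r ∂Measure.volumeIoiPow (Module.finrank ℝ E - 1) := by
  calc
    _ = ∫ x : ({(0)}ᶜ : Set E), f (‖x.1‖⁻¹ • x.1) * g ‖x.1‖ ∂(volume.comap Subtype.val) := by
      rw [integral_subtype_comap (measurableSet_singleton _).compl
        fun x : E ↦ f (‖x‖⁻¹ • x) * g ‖x‖, restrict_compl_singleton]
    _ = ∫ p, f p.1 * g p.2
        ∂(volume : Measure E).toSphere.prod (.volumeIoiPow (Module.finrank ℝ E - 1)) := by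
      simpa using (volume : Measure E).measurePreserving_homeomorphUnitSphereProd.integral_comp
        (Homeomorph.measurableEmbedding _)
        (fun p : Metric.sphere (0 : E) 1 × Set.Ioi (0 : ℝ) => f p.1 * g p.2)
    _ = _ := integral_prod_mul (fun z : Metric.sphere (0 : E) 1 => f z)
      (fun r : Set.Ioi (0 : ℝ) => g r)

lemma integral_uniformOnSphere (f : E → ℝ) :
    ∫ z, f z ∂uniformOnSphere E = ((volume : Measure E).toSphere.real Set.univ)⁻¹ *
      ∫ z, f z ∂(volume : Measure E).toSphere := by
  rw [uniformOnSphere, (MeasurableEmbedding.subtype_coe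
    Metric.isClosed_sphere.measurableSet).integral_map, integral_smul_measure,
    ENNReal.toReal_inv, smul_eq_mul, measureReal_def]

lemma ae_norm_eq_one_uniformOnSphere : ∀ᵐ z ∂uniformOnSphere E, ‖z‖ = 1 := by
  rw [uniformOnSphere, ae_map_iff measurable_subtype_coe.aemeasurable
    (measurableSet_eq_fun measurable_norm measurable_const)]
  exact Filter.Eventually.of_forall fun z => norm_eq_of_mem_sphere z

lemma integrable_direction_mul {f : E → ℝ} (hf : Continuous f) {g : E → ℝ} (hg : Integrable g) :
    Integrable (fun x : E => f (‖x‖⁻¹ • x) * g x) := by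
  obtain ⟨C, hC⟩ := (isCompact_closedBall (0 : E) 1).exists_bound_of_continuousOn hf.continuousOn
  refine hg.bdd_mul (c := C) ?_ (Filter.Eventually.of_forall fun x => hC _ ?_)
  · exact (hf.measurable.comp (measurable_norm.inv.smul measurable_id)).aestronglyMeasurable
  · simpa using norm_inv_norm_smul_le_one x

variable [Nontrivial E]

/-- The direction and the norm are independent under a rotation invariant density. -/
lemma integral_uniformOnSphere_mul_integral (f : E → ℝ) (g : ℝ → ℝ) :
    (∫ z, f z ∂uniformOnSphere E) * ∫ x : E, g ‖x‖ = ∫ x : E, f (‖x‖⁻¹ • x) * g ‖x‖ := by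
  have h := integral_direction_mul_norm (E := E) (fun _ => 1) g
  have h0 : (volume : Measure E).toSphere.real Set.univ ≠ 0 := by
    rw [measureReal_ne_zero_iff]
    exact mt Measure.measure_univ_eq_zero.mp (Measure.toSphere_ne_zero volume)
  simp only [one_mul, integral_const, smul_eq_mul, mul_one] at h
  rw [h, integral_uniformOnSphere, integral_direction_mul_norm]
  field_simp

/-- The Laplace transform of the uniform distribution on the sphere is dominated by that of the
centred Gaussian distribution with the same covariance. -/
theorem integral_rexp_inner_uniformOnSphere_le (v : E) :
    ∫ z, Real.exp ⟪v, z⟫_ℝ ∂uniformOnSphere E ≤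
      Real.exp (‖v‖ ^ 2 / (2 * Module.finrank ℝ E)) := by
  set n : ℝ := (Module.finrank ℝ E : ℝ) with hn
  have hn0 : 0 < n := by rw [hn]; exact_mod_cast Module.finrank_pos
  -- With this scaling `⟪w, x⟫` is `t = ‖x‖ / √n` times `⟪v, ‖x‖⁻¹ • x⟫`, and `t ^ 2` has Gaussian
  -- mean `1`.
  set w : E := (√n)⁻¹ • v with hw
  set G : E → ℝ := fun x => Real.exp (-‖x‖ ^ 2 / 2) with hG
  have hGi : Integrable G := integrable_rexp_neg_sq_norm_div_two
  have hGpos : 0 < ∫ x, G x := integral_exp_pos hGi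
  have hG2 : ∀ w : E, (fun x => Real.exp ⟪w, x⟫_ℝ * G x) =
      fun x => Real.exp (-(1 / 2) * ‖x‖ ^ 2 + ⟪w, x⟫_ℝ) := by
    intro w
    funext x
    rw [hG, ← Real.exp_add]
    ring_nf
  have hGw : ∀ w : E, Integrable (fun x => Real.exp ⟪w, x⟫_ℝ * G x) := by
    intro w
    rw [hG2]
    exact integrable_rexp_neg_mul_sq_norm_add_inner (by norm_num) w
  have hGint : ∀ w : E, ∫ x, Real.exp ⟪w, x⟫_ℝ * G x =
      Real.exp (‖w‖ ^ 2 / 2) * ∫ x, G x := by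
    have h : ∀ w : E, ∫ x, Real.exp ⟪w, x⟫_ℝ * G x =
        (Real.pi / (1 / 2)) ^ (n / 2) * Real.exp (‖w‖ ^ 2 / (4 * (1 / 2))) := by
      intro w
      rw [hG2, integral_rexp_neg_mul_sq_norm_add_inner (by norm_num) w]
    have h0 := h 0
    simp only [inner_zero_left, Real.exp_zero, one_mul, norm_zero] at h0
    intro w
    rw [h0, h]
    norm_num
    ring_nf
  -- `H (‖x‖⁻¹ • x) * K x` is the first-order term of the tangent line, weighted by `G`. It factors
  -- into direction and norm, so its integral is zero.
  set H : E → ℝ := fun z => ⟪v, z⟫_ℝ * Real.sinh ⟪v, z⟫_ℝ / (2 * n) with hH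
  have hHc : Continuous H := by rw [hH]; fun_prop
  set K : E → ℝ := fun x => (‖x‖ ^ 2 - n) * Real.exp (-‖x‖ ^ 2 / 2) with hK
  have hKi : Integrable K := by
    simp_rw [hK, sub_mul]
    exact integrable_sq_norm_mul_rexp_neg_sq_norm_div_two.sub (hGi.const_mul n)
  have hHK : ∫ x, H (‖x‖⁻¹ • x) * K x = 0 := by
    rw [hK, ← integral_uniformOnSphere_mul_integral H
      (fun r => (r ^ 2 - n) * Real.exp (-r ^ 2 / 2)), integral_sq_norm_sub_finrank_mul_rexp,
      mul_zero]
  have hE : ∀ v : E, Integrable (fun x : E => Real.exp ⟪v, ‖x‖⁻¹ • x⟫_ℝ * G x) := fun v =>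
    integrable_direction_mul (f := fun z => Real.exp ⟪v, z⟫_ℝ) (by fun_prop) hGi
  -- Only the even part of `exp` survives the symmetry `x ↦ -x`; it is the part that is convex in
  -- the squared radius.
  have hsymm : ∫ x : E, Real.exp ⟪v, ‖x‖⁻¹ • x⟫_ℝ * G x =
      ∫ x : E, Real.cosh ⟪v, ‖x‖⁻¹ • x⟫_ℝ * G x := by
    have h1 : ∫ x : E, Real.exp ⟪-v, ‖x‖⁻¹ • x⟫_ℝ * G x =
        ∫ x : E, Real.exp ⟪v, ‖x‖⁻¹ • x⟫_ℝ * G x := by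
      rw [← integral_neg_eq_self]
      simp [hG]
    have h2 : ∀ x : E, Real.cosh ⟪v, ‖x‖⁻¹ • x⟫_ℝ * G x =
        2⁻¹ * (Real.exp ⟪v, ‖x‖⁻¹ • x⟫_ℝ * G x + Real.exp ⟪-v, ‖x‖⁻¹ • x⟫_ℝ * G x) := by
      intro x
      rw [Real.cosh_eq, inner_neg_left]
      ring
    simp_rw [h2]
    rw [integral_const_mul, integral_add (hE v) (hE (-v)), h1]
    ring
  have hC : Integrable (fun x : E => Real.cosh ⟪v, ‖x‖⁻¹ • x⟫_ℝ * G x) :=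
    integrable_direction_mul (f := fun z => Real.cosh ⟪v, z⟫_ℝ) (by fun_prop) hGi
  have hcosh : ∀ x : E, Real.cosh ⟪w, x⟫_ℝ * G x =
        2⁻¹ * (Real.exp ⟪w, x⟫_ℝ * G x + Real.exp ⟪-w, x⟫_ℝ * G x) := by
    intro x
    rw [Real.cosh_eq, inner_neg_left]
    ring
  have hmain : ∫ x : E, (Real.cosh ⟪v, ‖x‖⁻¹ • x⟫_ℝ * G x + H (‖x‖⁻¹ • x) * K x) ≤
      ∫ x : E, Real.cosh ⟪w, x⟫_ℝ * G x := by
    refine integral_mono (hC.add (integrable_direction_mul hHc hKi)) ?_ fun x => ?_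
    · simp_rw [hcosh]
      exact ((hGw w).add (hGw (-w))).const_mul _
    · have h := cosh_add_mul_sinh_le_cosh_mul ⟪v, ‖x‖⁻¹ • x⟫_ℝ ((√n)⁻¹ * ‖x‖)
      have e1 : (√n)⁻¹ * ‖x‖ * ⟪v, ‖x‖⁻¹ • x⟫_ℝ = ⟪w, x⟫_ℝ := by
        rcases eq_or_ne x 0 with rfl | hx
        · simp
        · rw [hw, real_inner_smul_left, real_inner_smul_right]
          have := norm_ne_zero_iff.mpr hx
          field_simp
      rw [e1, mul_pow, inv_pow, Real.sq_sqrt hn0.le] at h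
      calc _ = (Real.cosh ⟪v, ‖x‖⁻¹ • x⟫_ℝ + ⟪v, ‖x‖⁻¹ • x⟫_ℝ * Real.sinh ⟪v, ‖x‖⁻¹ • x⟫_ℝ / 2 *
            (n⁻¹ * ‖x‖ ^ 2 - 1)) * G x := by
            simp only [hH, hK, hG]
            field_simp
        _ ≤ _ := by
          gcongr
  rw [integral_add hC (integrable_direction_mul hHc hKi), hHK, add_zero, ← hsymm,
    ← integral_uniformOnSphere_mul_integral (fun z => Real.exp ⟪v, z⟫_ℝ)
      (fun r => Real.exp (-r ^ 2 / 2))] at hmain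
  simp_rw [hcosh] at hmain
  rw [integral_const_mul, integral_add (hGw w) (hGw (-w)), hGint, hGint, norm_neg, ← two_mul,
    inv_mul_cancel_left₀ two_ne_zero] at hmain
  refine (le_of_mul_le_mul_right hmain hGpos).trans_eq ?_
  rw [hw, norm_smul, mul_pow, norm_inv, inv_pow, Real.norm_of_nonneg (Real.sqrt_nonneg _),
    Real.sq_sqrt hn0.le]
  congr 1
  field_simp

end Sphere

/-! ### Sums of independent vectors on the sphere -/

section IndependentSum

variable {Ω : Type*} [MeasurableSpace Ω] {P : Measure Ω}
  {E : Type*} [NormedAddCommGroup E] [InnerProductSpace ℝ E] [FiniteDimensional ℝ E]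
  [MeasurableSpace E] [BorelSpace E] [Nontrivial E] {ι : Type*} [Fintype ι]

/-- Adjoints move each `A j` onto `v`, and independence factors the expectation. Operators rather
than real scalars are allowed so that complex coefficients are covered. -/
lemma lintegral_rexp_inner_sum_le {Z : ι → Ω → E}
    (hZ : ∀ j, HasLaw (Z j) (uniformOnSphere E) P) (hind : iIndepFun Z P)
    {A : ι → E →L[ℝ] E} {α : ι → ℝ} (hA : ∀ j, ‖A j‖ ≤ α j) (v : E) :
    ∫⁻ ω, ENNReal.ofReal (Real.exp ⟪v, ∑ j, A j (Z j ω)⟫_ℝ) ∂P ≤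
      ENNReal.ofReal (Real.exp ((∑ j, α j ^ 2) / Module.finrank ℝ E * ‖v‖ ^ 2 / 2)) := by
  have : IsProbabilityMeasure P := hind.isProbabilityMeasure
  set w : ι → E := fun j => (A j).adjoint v with hw
  have hwv : ∀ j, ‖w j‖ ≤ α j * ‖v‖ := fun j =>
    ((A j).adjoint.le_opNorm v).trans (by
      rw [LinearIsometryEquiv.norm_map]
      gcongr
      exact hA j)
  set X : ι → Ω → ℝ := fun j ω => ⟪w j, Z j ω⟫_ℝ with hX
  have hsum : ∀ ω, ⟪v, ∑ j, A j (Z j ω)⟫_ℝ = (∑ j, X j) ω := by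
    intro ω
    simp only [inner_sum, Finset.sum_apply, hX, hw, ContinuousLinearMap.adjoint_inner_left]
  have hXm : ∀ j, AEMeasurable (X j) P := fun j => aemeasurable_const.inner (hZ j).aemeasurable
  have hXind : iIndepFun X P :=
    hind.comp (fun j z => ⟪w j, z⟫_ℝ) fun j => measurable_const.inner measurable_id
  have hmgf := hXind.mgf_sum₀ (t := 1) hXm Finset.univ
  have hXj : ∀ j, mgf (X j) P 1 ≤ Real.exp (α j ^ 2 / Module.finrank ℝ E * ‖v‖ ^ 2 / 2) := by
    intro j
    have h := (hZ j).integral_comp (f := fun z => Real.exp ⟪w j, z⟫_ℝ)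
      (by fun_prop : Continuous fun z => Real.exp ⟪w j, z⟫_ℝ).aestronglyMeasurable
    simp only [mgf, one_mul]
    refine (h.trans_le (integral_rexp_inner_uniformOnSphere_le (w j))).trans ?_
    rw [Real.exp_le_exp, div_mul_eq_mul_div, div_div, mul_comm (2 : ℝ), ← mul_pow]
    gcongr
    exact hwv j
  have hbound : ∀ᵐ ω ∂P, ‖Real.exp ((∑ j, X j) ω)‖ ≤ Real.exp (∑ j, ‖w j‖) := by
    have h : ∀ j, ∀ᵐ ω ∂P, ‖Z j ω‖ = 1 := fun j =>
      ae_of_ae_map (hZ j).aemeasurable ((hZ j).map_eq ▸ ae_norm_eq_one_uniformOnSphere)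
    filter_upwards [ae_all_iff.mpr h] with ω hω
    rw [Real.norm_of_nonneg (Real.exp_pos _).le, Real.exp_le_exp, Finset.sum_apply]
    gcongr with j
    simpa [hω j] using real_inner_le_norm (w j) (Z j ω)
  have hint : Integrable (fun ω => Real.exp ((∑ j, X j) ω)) P :=
    Integrable.of_bound (Finset.aemeasurable_sum _ fun j _ => hXm j).exp.aestronglyMeasurable _
      hbound
  simp_rw [hsum]
  rw [← ofReal_integral_eq_lintegral_ofReal hint
    (Filter.Eventually.of_forall fun ω => (Real.exp_pos _).le)]
  refine ENNReal.ofReal_le_ofReal ?_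
  simp only [mgf, one_mul] at hmgf hXj
  rw [hmgf, Finset.sum_div, Finset.sum_mul, Finset.sum_div, Real.exp_sum]
  exact Finset.prod_le_prod (fun j _ => integral_nonneg fun ω => (Real.exp_pos _).le)
    fun j _ => hXj j

lemma lintegral_rexp_mul_sq_norm_sum_le {Z : ι → Ω → E}
    (hZ : ∀ j, HasLaw (Z j) (uniformOnSphere E) P) (hind : iIndepFun Z P)
    {A : ι → E →L[ℝ] E} {α : ι → ℝ} (hA : ∀ j, ‖A j‖ ≤ α j) {s : ℝ} (hs : 0 < s)
    (hsα : 2 * s * (∑ j, α j ^ 2) < Module.finrank ℝ E) :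
    ∫⁻ ω, ENNReal.ofReal (Real.exp (s * ‖∑ j, A j (Z j ω)‖ ^ 2)) ∂P ≤
      ENNReal.ofReal ((1 - 2 * s * (∑ j, α j ^ 2) / Module.finrank ℝ E) ^
        (-(Module.finrank ℝ E : ℝ) / 2)) := by
  have : IsProbabilityMeasure P := hind.isProbabilityMeasure
  have hn : (0 : ℝ) < Module.finrank ℝ E := by exact_mod_cast Module.finrank_pos
  have hm : AEMeasurable (fun ω => ∑ j, A j (Z j ω)) P :=
    Finset.aemeasurable_fun_sum _ fun j _ => (A j).measurable.comp_aemeasurable (hZ j).aemeasurable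
  have h := lintegral_rexp_mul_sq_norm_le hm hs
    (τ := (∑ j, α j ^ 2) / Module.finrank ℝ E) (by rwa [← mul_div_assoc, div_lt_one hn])
    (lintegral_rexp_inner_sum_le hZ hind hA)
  rwa [← mul_div_assoc] at h

/-- The exponential moments of a sum of two squared norms, by convexity of the exponential. -/
lemma lintegral_rexp_mul_sq_norm_add_sq_norm_le {Z : ι → Ω → E}
    (hZ : ∀ j, HasLaw (Z j) (uniformOnSphere E) P) (hind : iIndepFun Z P)
    (b c : ι → ℝ) {s : ℝ} (hs : 0 < s) {τ : ℝ} (hτ : 0 < τ)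
    (hbc : ∑ j, b j ^ 2 + ∑ j, c j ^ 2 = τ) (hsτ : 2 * s * τ < Module.finrank ℝ E) :
    ∫⁻ ω, ENNReal.ofReal
        (Real.exp (s * (‖∑ j, b j • Z j ω‖ ^ 2 + ‖∑ j, c j • Z j ω‖ ^ 2))) ∂P ≤
      ENNReal.ofReal ((1 - 2 * s * τ / Module.finrank ℝ E) ^
        (-(Module.finrank ℝ E : ℝ) / 2)) := by
  set M := ENNReal.ofReal ((1 - 2 * s * τ / Module.finrank ℝ E) ^
        (-(Module.finrank ℝ E : ℝ) / 2)) with hM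
  -- The weight `p = (∑ j, b j ^ 2) / τ` is the share of `b` in `τ`. Replacing `s` by `s / p`
  -- cancels it, so both parts get the same bound `M`.
  have hB : ∀ b : ι → ℝ, ENNReal.ofReal ((∑ j, b j ^ 2) / τ) * ∫⁻ ω, ENNReal.ofReal
      (Real.exp (s / ((∑ j, b j ^ 2) / τ) * ‖∑ j, b j • Z j ω‖ ^ 2)) ∂P ≤
      ENNReal.ofReal ((∑ j, b j ^ 2) / τ) * M := by
    intro b
    rcases (Finset.sum_nonneg fun j (_ : j ∈ Finset.univ) => sq_nonneg (b j)).eq_or_lt with h0 | h0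
    · simp [← h0]
    · gcongr
      have e : 2 * (s / ((∑ j, b j ^ 2) / τ)) * ∑ j, |b j| ^ 2 = 2 * s * τ := by
        simp only [sq_abs]
        field_simp
      have h := lintegral_rexp_mul_sq_norm_sum_le hZ hind
        (A := fun j => b j • ContinuousLinearMap.id ℝ E) (α := fun j => |b j|)
        (fun j => by simp [norm_smul]) (s := s / ((∑ j, b j ^ 2) / τ)) (by positivity)
        (by rwa [e])
      rw [e] at h
      simpa using h
  -- If the weight is zero then so is `b`, and the junk value of `s / 0` does no harm.
  have hzero : ∀ (b : ι → ℝ) (ω : Ω), (∑ j, b j ^ 2) / τ *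
      (s / ((∑ j, b j ^ 2) / τ) * ‖∑ j, b j • Z j ω‖ ^ 2) = s * ‖∑ j, b j • Z j ω‖ ^ 2 := by
    intro b ω
    by_cases h0 : ∑ j, b j ^ 2 = 0
    · rw [Finset.sum_eq_zero_iff_of_nonneg fun j _ => sq_nonneg (b j)] at h0
      have : ∀ j, b j = 0 := fun j => by simpa using h0 j (Finset.mem_univ j)
      simp [this]
    · field_simp
  have hnn : ∀ b : ι → ℝ, 0 ≤ (∑ j, b j ^ 2) / τ := fun b => by positivity
  have hone : (∑ j, b j ^ 2) / τ + (∑ j, c j ^ 2) / τ = 1 := by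
    rw [← add_div, hbc, div_self hτ.ne']
  have hmeas : AEMeasurable (fun ω => ENNReal.ofReal
      (Real.exp (s / ((∑ j, b j ^ 2) / τ) * ‖∑ j, b j • Z j ω‖ ^ 2))) P :=
    (((Finset.aemeasurable_fun_sum _ fun j _ =>
      (hZ j).aemeasurable.const_smul (b j)).norm.pow_const 2).const_mul _).exp.ennreal_ofReal
  calc _ ≤ ∫⁻ ω, (ENNReal.ofReal ((∑ j, b j ^ 2) / τ) * ENNReal.ofReal
          (Real.exp (s / ((∑ j, b j ^ 2) / τ) * ‖∑ j, b j • Z j ω‖ ^ 2)) +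
        ENNReal.ofReal ((∑ j, c j ^ 2) / τ) * ENNReal.ofReal
          (Real.exp (s / ((∑ j, c j ^ 2) / τ) * ‖∑ j, c j • Z j ω‖ ^ 2))) ∂P := by
        gcongr with ω
        rw [← ENNReal.ofReal_mul (hnn b), ← ENNReal.ofReal_mul (hnn c), ← ENNReal.ofReal_add
          (mul_nonneg (hnn b) (Real.exp_pos _).le) (mul_nonneg (hnn c) (Real.exp_pos _).le)]
        refine ENNReal.ofReal_le_ofReal ?_
        have h := convexOn_exp.2
          (Set.mem_univ (s / ((∑ j, b j ^ 2) / τ) * ‖∑ j, b j • Z j ω‖ ^ 2))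
          (Set.mem_univ (s / ((∑ j, c j ^ 2) / τ) * ‖∑ j, c j • Z j ω‖ ^ 2))
          (hnn b) (hnn c) hone
        simp only [smul_eq_mul, hzero] at h
        rwa [mul_add]
    _ ≤ ENNReal.ofReal ((∑ j, b j ^ 2) / τ) * M + ENNReal.ofReal ((∑ j, c j ^ 2) / τ) * M := by
        rw [lintegral_add_left' (hmeas.const_mul _),
          lintegral_const_mul' _ _ ENNReal.ofReal_ne_top,
          lintegral_const_mul' _ _ ENNReal.ofReal_ne_top]
        exact add_le_add (hB b) (hB c)
    _ = M := by
        rw [← add_mul, ← ENNReal.ofReal_add (hnn b) (hnn c), hone, ENNReal.ofReal_one, one_mul]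

end IndependentSum

/-! ### Chernoff's bound and the two cases -/

/-- Chernoff's bound for a variable whose exponential moments are at most those of `τ / d` times
a chi-squared variable with `d` degrees of freedom. -/
lemma measureReal_le_of_lintegral_rexp_le {Ω : Type*} [MeasurableSpace Ω] {P : Measure Ω}
    {X : Ω → ℝ} (hX : AEMeasurable X P) {τ d : ℝ} (hτ : 0 < τ) (hd : 0 < d)
    (h : ∀ s : ℝ, 0 < s → 2 * s * τ < d → ∫⁻ ω, ENNReal.ofReal (Real.exp (s * X ω)) ∂P ≤
      ENNReal.ofReal ((1 - 2 * s * τ / d) ^ (-d / 2)))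
    {u : ℝ} (hu : 1 < u) :
    P.real {ω | u ^ 2 * τ ≤ X ω} ≤
      Real.exp (-(d / 2) * (u ^ 2 - Real.log (u ^ 2) - 1)) := by
  have hu2 : 1 < u ^ 2 := one_lt_pow₀ hu two_ne_zero
  have hu0 : 0 < u ^ 2 := by positivity
  -- The minimiser of `-s * u ^ 2 * τ - (d / 2) * log (1 - 2 * s * τ / d)`, where `1 - 2 * s * τ / d
  -- = 1 / u ^ 2`.
  obtain ⟨s, hs⟩ : ∃ s : ℝ, s = d * (1 - 1 / u ^ 2) / (2 * τ) := ⟨_, rfl⟩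
  have hinv : 1 / u ^ 2 < 1 := by rwa [div_lt_one hu0]
  have hs0 : 0 < s := by
    rw [hs]
    have : 0 < 1 - 1 / u ^ 2 := by linarith
    positivity
  have hsτ : 2 * s * τ = d * (1 - 1 / u ^ 2) := by rw [hs]; field_simp
  have hsτd : 2 * s * τ < d := by
    rw [hsτ]
    have : 0 < 1 / u ^ 2 := by positivity
    nlinarith
  have hM := h s hs0 hsτd
  rw [hsτ, mul_div_cancel_left₀ _ hd.ne', sub_sub_cancel, one_div,
    Real.inv_rpow hu0.le, neg_div, Real.rpow_neg hu0.le, inv_inv, Real.rpow_def_of_pos hu0] at hM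
  have hmarkov := mul_meas_ge_le_lintegral₀ (hX.const_mul s).exp.ennreal_ofReal
    (ENNReal.ofReal (Real.exp (s * (u ^ 2 * τ))))
  have hset : {ω | ENNReal.ofReal (Real.exp (s * (u ^ 2 * τ))) ≤
      ENNReal.ofReal (Real.exp (s * X ω))} = {ω | u ^ 2 * τ ≤ X ω} := by
    ext ω
    simp only [Set.mem_ofPred_eq]
    rw [ENNReal.ofReal_le_ofReal_iff (Real.exp_pos _).le, Real.exp_le_exp,
      mul_le_mul_iff_right₀ hs0]
  rw [hset] at hmarkov
  have h2 := ENNReal.toReal_mono ENNReal.ofReal_ne_top (hmarkov.trans hM)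
  rw [ENNReal.toReal_mul, ENNReal.toReal_ofReal (Real.exp_pos _).le,
    ENNReal.toReal_ofReal (Real.exp_pos _).le, ← le_div_iff₀' (Real.exp_pos _),
    ← Real.exp_sub] at h2
  refine h2.trans_eq ?_
  congr 1
  have : s * (u ^ 2 * τ) = d / 2 * (u ^ 2 - 1) := by
    rw [hs]
    field_simp
  rw [this]
  ring

lemma sq_norm_sum_smul_realToComplex {ι : Type*} [Fintype ι] {L : ℕ} (a : ι → ℂ)
    (x : ι → EuclideanSpace ℝ (Fin L)) :
    ‖∑ j, a j • realToComplex (x j)‖ ^ 2 =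
      ‖∑ j, (a j).re • x j‖ ^ 2 + ‖∑ j, (a j).im • x j‖ ^ 2 := by
  simp only [EuclideanSpace.norm_sq_eq, ← Finset.sum_add_distrib]
  refine Finset.sum_congr rfl fun i _ => ?_
  simp [realToComplex, Complex.sq_norm, Complex.normSq_apply, ← sq]

theorem mainTheorem3 {Ω : Type*} [MeasurableSpace Ω] (P : Measure Ω) [IsProbabilityMeasure P]
    (k L : ℕ) (hL : 1 ≤ L) (a : EuclideanSpace ℂ (Fin k)) (ha : a ≠ 0) :
    (∀ Z : Fin k → Ω → EuclideanSpace ℝ (Fin L),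
      (∀ j, HasLaw (Z j) (uniformOnSphere (EuclideanSpace ℝ (Fin L))) P) →
      iIndepFun Z P →
      ∀ u : ℝ, 1 < u →
        P.real {ω | u * ‖a‖ ≤ ‖∑ j, a j • realToComplex (Z j ω)‖} ≤
          Real.exp (-((L : ℝ) / 2) * (u ^ 2 - Real.log (u ^ 2) - 1))) ∧
    (∀ Z : Fin k → Ω → EuclideanSpace ℂ (Fin L),
      (∀ j, HasLaw (Z j) (uniformOnSphere (EuclideanSpace ℂ (Fin L))) P) →
      iIndepFun Z P →
      ∀ u : ℝ, 1 < u →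
        P.real {ω | u * ‖a‖ ≤ ‖∑ j, a j • Z j ω‖} ≤
          Real.exp (-(L : ℝ) * (u ^ 2 - Real.log (u ^ 2) - 1))) := by
  have : Nonempty (Fin L) := ⟨⟨0, hL⟩⟩
  have hL0 : (0 : ℝ) < L := by exact_mod_cast hL
  have hτ : 0 < ‖a‖ ^ 2 := by positivity
  have hset : ∀ (S : Ω → EuclideanSpace ℂ (Fin L)) (u : ℝ), 1 < u →
      {ω | u * ‖a‖ ≤ ‖S ω‖} = {ω | u ^ 2 * ‖a‖ ^ 2 ≤ ‖S ω‖ ^ 2} := by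
    intro S u hu
    ext ω
    rw [Set.mem_ofPred_eq, Set.mem_ofPred_eq, ← mul_pow,
      pow_le_pow_iff_left₀ (by positivity) (norm_nonneg _) two_ne_zero]
  refine ⟨fun Z hZ hind u hu => ?_, fun Z hZ hind u hu => ?_⟩
  · have hn : Module.finrank ℝ (EuclideanSpace ℝ (Fin L)) = L := by simp
    have hsum : ∑ j, (a j).re ^ 2 + ∑ j, (a j).im ^ 2 = ‖a‖ ^ 2 := by
      rw [EuclideanSpace.norm_sq_eq, ← Finset.sum_add_distrib]
      simp [Complex.sq_norm, Complex.normSq_apply, ← sq]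
    have hm : ∀ b : Fin k → ℝ, AEMeasurable (fun ω => ∑ j, b j • Z j ω) P := fun b =>
      Finset.aemeasurable_fun_sum _ fun j _ => (hZ j).aemeasurable.const_smul (b j)
    rw [hset _ u hu]
    simp_rw [sq_norm_sum_smul_realToComplex]
    refine measureReal_le_of_lintegral_rexp_le
      (((hm fun j => (a j).re).norm.pow_const 2).add ((hm fun j => (a j).im).norm.pow_const 2))
      hτ hL0 (fun s hs hsd => ?_) hu
    have h := lintegral_rexp_mul_sq_norm_add_sq_norm_le hZ hind (fun j => (a j).re)
      (fun j => (a j).im) hs hτ hsum (by rwa [hn])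
    rwa [hn] at h
  · have hn : Module.finrank ℝ (EuclideanSpace ℂ (Fin L)) = 2 * L := by
      rw [← Module.finrank_mul_finrank ℝ ℂ, Complex.finrank_real_complex, finrank_euclideanSpace,
        Fintype.card_fin]
    have hm : AEMeasurable (fun ω => ∑ j, a j • Z j ω) P :=
      Finset.aemeasurable_fun_sum _ fun j _ => (hZ j).aemeasurable.const_smul (a j)
    rw [hset _ u hu]
    -- The real dimension `2 * L` doubles the rate of the real case.
    have key := measureReal_le_of_lintegral_rexp_le (hm.norm.pow_const 2) hτ
      (d := ((2 * L : ℕ) : ℝ)) (by positivity) (fun s hs hsd => ?_) hu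
    · refine key.trans_eq ?_
      push_cast
      rw [mul_div_cancel_left₀ _ two_ne_zero]
    · have h := lintegral_rexp_mul_sq_norm_sum_le hZ hind
        (A := fun j => a j • ContinuousLinearMap.id ℝ (EuclideanSpace ℂ (Fin L)))
        (α := fun j => ‖a j‖) (fun j => ?_) hs
        (by rwa [hn, ← EuclideanSpace.norm_sq_eq])
      · rw [hn, ← EuclideanSpace.norm_sq_eq] at h
        simpa using h
      · refine ContinuousLinearMap.opNorm_le_bound _ (norm_nonneg _) fun z => ?_
        simp [norm_smul]
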